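/- Let $\nu\ge 0$ and let $I_\nu(x)=\sum_{k\ge0}\frac{(x/2)^{2k+\nu}}{k!\,\Gamma(\nu+k+1)}$ be the modified Bessel function of the first kind. For real $n>0$ the integral $$\hat{\mathcal I}_n=\int_0^\infty\left(\frac{\Gamma(1+\nu)I_\nu(x)}{(x/2)^\nu}\right)^{-n}dx$$ converges. Put $\psi(x)=\log\bigl(\Gamma(1+\nu)I_\nu(x)/(x/2)^\nu\bigr)$ for $x>0$. Then there are $\tau_0>0$, a differentiable function $x=x(\tau)>0$ on $(0,\tau_0)$ that inverts the change of variable $\tau^2=\psi(x)$ (that is, $\psi(x(\tau))=\tau^2$), and real numbers $\hat A_k$ ($k\ge 0$) such that $$\frac{1}{2\sqrt{1+\nu}}\,\frac{dx}{d\tau}=\sum_{k=0}^\infty \hat A_k\tau^{2k}\qquad(0<\tau<\tau_0),$$ and, as $n\to\infty$ through the real numbers, $$\hat{\mathcal I}_n\sim(1+\nu)^{1/2}\sum_{k=0}^\infty\frac{\hat A_k\,\Gamma(k+\frac12)}{n^{k+1/2}}$$ in the sense of Poincaré: for every integer $N\ge0$, $$\hat{\mathcal I}_n-(1+\nu)^{1/2}\sum_{k=0}^{N-1}\frac{\hat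 A_k\,\Gamma(k+\frac12)}{n^{k+1/2}}=O\bigl(n^{-N-1/2}\bigr)\qquad(n\to\infty).$$ The first coefficients are $$\hat A_0=1,\qquad \hat A_1=\frac{3}{4(2+\nu)},\qquad \hat A_2=-\frac{5(1+11\nu)}{96(2+\nu)^2(3+\nu)},$$ $$\hat A_3=-\frac{7(20+9\nu-17\nu^2)}{128(2+\nu)^3(3+\nu)(4+\nu)},$$ $$\hat A_4=\frac{75404+262439\nu+182205\nu^2-28031\nu^3-19409\nu^4}{10240(2+\nu)^4(3+\nu)^2(4+\nu)(5+\nu)},$$ $$\hat A_5=\frac{11(127864-364742\nu-1417421\nu^2-966731\nu^3+8605\nu^4+48361\nu^5)}{122880(2+\nu)^5(3+\nu)^2(4+\nu)(5+\nu)(6+\nu)}.$$ -/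

import Mathlib

open Filter Asymptotics MeasureTheory Set

/-- The modified Bessel function of the first kind `I_ν(x)`, for real order `ν` and `x > 0`,
by its standard series `∑ (x/2)^(2k+ν) / (k! Γ(ν+k+1))`. -/
noncomputable def besselI (ν x : ℝ) : ℝ :=
  ∑' k : ℕ, (x / 2) ^ (2 * (k : ℝ) + ν) / ((k.factorial : ℝ) * Real.Gamma (ν + k + 1))

/-- The normalised function `Γ(1+ν) I_ν(x) / (x/2)^ν`, for `x > 0`. -/
noncomputable def besselINorm (ν x : ℝ) : ℝ :=
  Real.Gamma (1 + ν) * besselI ν x / (x / 2) ^ ν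

/-- The integrand `(Γ(1+ν) I_ν(x) / (x/2)^ν)^(-n)`, for real `n`. -/
noncomputable def besselIntegrand (ν n x : ℝ) : ℝ :=
  besselINorm ν x ^ (-n)

/-- The integral of `(Γ(1+ν) I_ν(x) / (x/2)^ν)^(-n)` over `(0, ∞)`. -/
noncomputable def besselIntegral (ν n : ℝ) : ℝ :=
  ∫ x in Ioi (0 : ℝ), besselIntegrand ν n x

/-- The phase function `ψ(x) = log (Γ(1+ν) I_ν(x) / (x/2)^ν)`. -/
noncomputable def besselPhase (ν x : ℝ) : ℝ :=
  Real.log (besselINorm ν x)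

/-- `A` is the sequence of coefficients of the expansion
`(1 / (2 √(1+ν))) dx/dτ = ∑ A_k τ^(2k)`, convergent for `0 < τ < τ₀` with some `τ₀ > 0`, where
`x = x(τ) > 0` is obtained by inverting the change of variable `τ² = ψ(x)`. -/
def IsInversionCoeff (ν : ℝ) (A : ℕ → ℝ) : Prop :=
  ∃ τ₀ : ℝ, 0 < τ₀ ∧ ∃ X : ℝ → ℝ, ∀ τ ∈ Ioo 0 τ₀,
    0 < X τ ∧ besselPhase ν (X τ) = τ ^ 2 ∧ DifferentiableAt ℝ X τ ∧
      HasSum (fun k : ℕ => A k * τ ^ (2 * k)) (1 / (2 * Real.sqrt (1 + ν)) * deriv X τ)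

/-! In the variable `w = x² / (4(1+ν))` the normalised Bessel function is an entire function `E`
with positive coefficients and `E(w) = 1 + w + ⋯`. Hence `u = log E(w)` can be inverted analytically
near `0` as `w = u p(u)²` with `p(0) = 1`. With `u = τ²` this reads `x = 2√(1+ν) τ p(τ²)`, so `dx/dτ
= 2√(1+ν) g(τ²)` where `g = p + 2up'`, and the `A_k` are the Taylor coefficients of `g`.

The asymptotics are Laplace's method. Near `0` the substitution turns the integrand into `exp(-nτ²)
g(τ²)`, to which Watson's lemma applies (`watson_even_isBigO`). Away from `0`, monotonicity of `E`
makes the rest exponentially small (`besselIntegral_tail_isBigO`).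

For the explicit values, Bessel's equation `wE'' + (1+ν)E' = (1+ν)E`, combined with two derivatives
of `E(u p²) = exp u`, yields a nonlinear equation in `p` and `g` free of `E`
(`inversion_profile_ode`). Its Taylor coefficients determine `A_1, …, A_5` successively. -/

/-! ### The entire function of `w` and its growth. -/

/-- The coefficients of the normalised Bessel function in the variable `x² / (4 (1+ν))`. -/
noncomputable def besselCoeff (ν : ℝ) (k : ℕ) : ℝ :=
  (1 + ν) ^ k * Real.Gamma (1 + ν) / ((k.factorial : ℝ) * Real.Gamma (ν + k + 1))

/-- The normalised Bessel function as an entire function of `w = x² / (4 (1+ν))`. -/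
noncomputable def besselEntire (ν : ℝ) : ℝ → ℝ :=
  FormalMultilinearSeries.ofScalarsSum (besselCoeff ν)

section
variable {ν : ℝ}

theorem besselCoeff_zero (hν : 0 ≤ ν) : besselCoeff ν 0 = 1 := by
  have : Real.Gamma (1 + ν) ≠ 0 := (Real.Gamma_pos_of_pos (by linarith)).ne'
  simp [besselCoeff, add_comm ν 1, this]

theorem besselCoeff_pos (hν : 0 ≤ ν) (k : ℕ) : 0 < besselCoeff ν k := by
  have h1 : 0 < Real.Gamma (1 + ν) := Real.Gamma_pos_of_pos (by linarith)
  have h2 : 0 < Real.Gamma (ν + k + 1) := Real.Gamma_pos_of_pos (by positivity)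
  have h3 : 0 < 1 + ν := by linarith
  unfold besselCoeff
  positivity

theorem besselCoeff_succ (hν : 0 ≤ ν) (k : ℕ) :
    ((k : ℝ) + 1) * (ν + k + 1) * besselCoeff ν (k + 1) = (1 + ν) * besselCoeff ν k := by
  have h2 : 0 < Real.Gamma (ν + k + 1) := Real.Gamma_pos_of_pos (by positivity)
  have h3 : (0 : ℝ) < ν + k + 1 := by positivity
  have h4 : Real.Gamma (ν + (k + 1 : ℕ) + 1) = (ν + k + 1) * Real.Gamma (ν + k + 1) := by
    rw [← Real.Gamma_add_one h3.ne']; push_cast; ring_nf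
  unfold besselCoeff
  rw [h4, Nat.factorial_succ]
  push_cast
  field_simp
  ring

/-- This is the purpose of the scaling by `4(1+ν)`: it gives `E'(0) = 1`, whence `p(0) = 1` and `A_0
= 1`. -/
theorem besselCoeff_one (hν : 0 ≤ ν) : besselCoeff ν 1 = 1 := by
  have h := besselCoeff_succ hν 0
  rw [besselCoeff_zero hν] at h
  have : (1 + ν) ≠ 0 := by linarith
  apply mul_left_cancel₀ this
  simp only [Nat.cast_zero] at h
  linarith

theorem tendsto_besselCoeff_ratio (hν : 0 ≤ ν) :
    Tendsto (fun n => ‖besselCoeff ν n.succ‖ / ‖besselCoeff ν n‖) atTop (nhds 0) := by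
  have hlim : Tendsto (fun n : ℕ => (1 + ν) * (1 / ((n : ℝ) + 1))) atTop (nhds 0) := by
    simpa using tendsto_one_div_add_atTop_nhds_zero_nat.const_mul (1 + ν)
  refine squeeze_zero (fun n => by positivity) (fun n => ?_) hlim
  have h0 := besselCoeff_pos hν n
  have h1 := besselCoeff_pos hν (n + 1)
  rw [Real.norm_of_nonneg h0.le, Real.norm_of_nonneg h1.le, div_le_iff₀ h0]
  have h := besselCoeff_succ hν n
  have hn : (0 : ℝ) < (n : ℝ) + 1 := by positivity
  rw [mul_one_div, div_mul_eq_mul_div, le_div_iff₀ hn, ← h]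
  have : (0 : ℝ) ≤ (n : ℝ) + 1 := hn.le
  have h2 : (1 : ℝ) ≤ ν + n + 1 := by have : (0 : ℝ) ≤ n := n.cast_nonneg; linarith
  have := mul_le_mul_of_nonneg_left h2 (mul_nonneg this h1.le)
  nlinarith

theorem besselEntire_hasFPowerSeriesOnBall (hν : 0 ≤ ν) :
    HasFPowerSeriesOnBall (besselEntire ν)
      (FormalMultilinearSeries.ofScalars ℝ (besselCoeff ν)) 0 ⊤ := by
  have h := FormalMultilinearSeries.ofScalars_radius_eq_top_of_tendsto ℝ (besselCoeff ν)
    (Eventually.of_forall fun n => (besselCoeff_pos hν n).ne') (tendsto_besselCoeff_ratio hν)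
  rw [← h]
  exact FormalMultilinearSeries.hasFPowerSeriesOnBall _ (by rw [h]; simp)

theorem besselEntire_hasSum (hν : 0 ≤ ν) (w : ℝ) :
    HasSum (fun k => besselCoeff ν k * w ^ k) (besselEntire ν w) := by
  have h := (besselEntire_hasFPowerSeriesOnBall hν).hasSum (y := w) (by simp)
  simpa [FormalMultilinearSeries.ofScalars_apply_eq, mul_comm] using h

theorem analyticAt_besselEntire (hν : 0 ≤ ν) (w : ℝ) : AnalyticAt ℝ (besselEntire ν) w :=
  (besselEntire_hasFPowerSeriesOnBall hν).analyticOnNhd w (by simp)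

theorem continuous_besselEntire (hν : 0 ≤ ν) : Continuous (besselEntire ν) :=
  continuous_iff_continuousAt.2 fun w => (analyticAt_besselEntire hν w).continuousAt

theorem besselEntire_zero (hν : 0 ≤ ν) : besselEntire ν 0 = 1 := by
  rw [besselEntire, FormalMultilinearSeries.ofScalarsSum_zero, besselCoeff_zero hν]; simp

theorem le_besselEntire (hν : 0 ≤ ν) {w : ℝ} (hw : 0 ≤ w) (m : ℕ) :
    besselCoeff ν m * w ^ m ≤ besselEntire ν w :=
  le_hasSum (besselEntire_hasSum hν w) m fun k _ =>
    mul_nonneg (besselCoeff_pos hν k).le (pow_nonneg hw k)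

theorem besselEntire_mono (hν : 0 ≤ ν) {v w : ℝ} (hv : 0 ≤ v) (hvw : v ≤ w) :
    besselEntire ν v ≤ besselEntire ν w :=
  hasSum_le (fun k => mul_le_mul_of_nonneg_left (pow_le_pow_left₀ hv hvw k)
    (besselCoeff_pos hν k).le) (besselEntire_hasSum hν v) (besselEntire_hasSum hν w)

theorem one_le_besselEntire (hν : 0 ≤ ν) {w : ℝ} (hw : 0 ≤ w) : 1 ≤ besselEntire ν w :=
  besselEntire_zero hν ▸ besselEntire_mono hν le_rfl hw

theorem one_lt_besselEntire (hν : 0 ≤ ν) {w : ℝ} (hw : 0 < w) : 1 < besselEntire ν w := by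
  have := sum_le_hasSum (Finset.range 2) (fun k _ =>
    mul_nonneg (besselCoeff_pos hν k).le (pow_nonneg hw.le k)) (besselEntire_hasSum hν w)
  simp [Finset.sum_range_succ, besselCoeff_zero hν, besselCoeff_one hν] at this
  linarith

theorem besselINorm_eq (hν : 0 ≤ ν) {x : ℝ} (hx : 0 < x) :
    besselINorm ν x = besselEntire ν (x ^ 2 / (4 * (1 + ν))) := by
  have hx2 : 0 < x / 2 := by positivity
  have h1 : (1 + ν) ≠ 0 := by linarith
  rw [besselINorm, besselI, mul_div_assoc, ← tsum_div_const, ← tsum_mul_left,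
    ← (besselEntire_hasSum hν _).tsum_eq]
  refine tsum_congr fun k => ?_
  have h2 : Real.Gamma (ν + k + 1) ≠ 0 := (Real.Gamma_pos_of_pos (by positivity)).ne'
  have h3 : (x / 2) ^ ν ≠ 0 := (Real.rpow_pos_of_pos hx2 ν).ne'
  have h4 : (x / 2) ^ (2 * (k : ℝ)) = (x ^ 2 / 4) ^ k := by
    rw [Real.rpow_mul hx2.le, Real.rpow_natCast]; congr 1; norm_num; ring
  rw [Real.rpow_add hx2, h4, besselCoeff]
  have h5 : x ^ 2 / (4 * (1 + ν)) = x ^ 2 / 4 / (1 + ν) := by field_simp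
  rw [h5, div_pow (x ^ 2 / 4) (1 + ν)]
  field_simp
end

/-! ### Taylor series at `0`, turning differential equations into identities of formal power series.
-/

/-- The formal Taylor series at `0` of a real function. -/
noncomputable def taylorSeriesZero (f : ℝ → ℝ) : PowerSeries ℝ :=
  PowerSeries.mk fun n => iteratedDeriv n f 0 / (n.factorial : ℝ)

section
variable {f g : ℝ → ℝ}

theorem taylorSeriesZero_congr (h : f =ᶠ[nhds 0] g) :
    taylorSeriesZero f = taylorSeriesZero g := by
  ext n
  simp [taylorSeriesZero, h.iteratedDeriv_eq n]

theorem taylorSeriesZero_mul (hf : AnalyticAt ℝ f 0) (hg : AnalyticAt ℝ g 0) :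
    taylorSeriesZero (fun u => f u * g u) = taylorSeriesZero f * taylorSeriesZero g := by
  ext n
  rw [PowerSeries.coeff_mul, taylorSeriesZero, PowerSeries.coeff_mk,
    iteratedDeriv_fun_mul hf.contDiffAt hg.contDiffAt, Finset.sum_div,
    Finset.Nat.sum_antidiagonal_eq_sum_range_succ_mk]
  refine Finset.sum_congr rfl fun i hi => ?_
  have hi' : i ≤ n := Nat.lt_succ_iff.1 (Finset.mem_range.1 hi)
  have := Nat.choose_mul_factorial_mul_factorial hi'
  have h1 : ((n.choose i : ℝ)) * i.factorial * (n - i).factorial = n.factorial := by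
    exact_mod_cast this
  simp only [taylorSeriesZero, PowerSeries.coeff_mk]
  have h2 : (i.factorial : ℝ) ≠ 0 := by positivity
  have h3 : ((n - i).factorial : ℝ) ≠ 0 := by positivity
  have h4 : (n.factorial : ℝ) ≠ 0 := by positivity
  field_simp
  rw [← h1]
  ring

theorem taylorSeriesZero_add (hf : AnalyticAt ℝ f 0) (hg : AnalyticAt ℝ g 0) :
    taylorSeriesZero (fun u => f u + g u) = taylorSeriesZero f + taylorSeriesZero g := by
  ext n
  simp [taylorSeriesZero, iteratedDeriv_fun_add hf.contDiffAt hg.contDiffAt, add_div]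

theorem taylorSeriesZero_const (c : ℝ) :
    taylorSeriesZero (fun _ => c) = PowerSeries.C c := by
  ext n
  rw [taylorSeriesZero, PowerSeries.coeff_mk, PowerSeries.coeff_C, iteratedDeriv_const]
  split_ifs with h <;> simp [h]

theorem taylorSeriesZero_id : taylorSeriesZero (fun u => u) = PowerSeries.X := by
  ext n
  have := iteratedDeriv_fun_pow_zero (𝕜 := ℝ) (n := n) (m := 1)
  simp only [pow_one] at this
  rw [taylorSeriesZero, PowerSeries.coeff_mk, PowerSeries.coeff_X, this]
  split_ifs with h <;> simp [h]

theorem coeff_taylorSeriesZero_deriv (n : ℕ) :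
    PowerSeries.coeff n (taylorSeriesZero (deriv f)) =
      ((n : ℝ) + 1) * PowerSeries.coeff (n + 1) (taylorSeriesZero f) := by
  simp only [taylorSeriesZero, PowerSeries.coeff_mk, iteratedDeriv_succ', Nat.factorial_succ]
  push_cast
  have : (n.factorial : ℝ) ≠ 0 := by positivity
  field_simp

theorem hasFPowerSeriesAt_taylorSeriesZero (hf : AnalyticAt ℝ f 0) :
    HasFPowerSeriesAt f (FormalMultilinearSeries.ofScalars ℝ fun n =>
      PowerSeries.coeff n (taylorSeriesZero f)) 0 := by
  simpa [taylorSeriesZero] using hf.hasFPowerSeriesAt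

theorem eventually_eq_zero_of_taylorSeriesZero (hf : AnalyticAt ℝ f 0)
    (h : taylorSeriesZero f = 0) : ∀ᶠ u in nhds 0, f u = 0 := by
  have := hasFPowerSeriesAt_taylorSeriesZero hf
  simp only [h, map_zero] at this
  have h0 : FormalMultilinearSeries.ofScalars ℝ (fun _ : ℕ => (0 : ℝ)) = 0 := by
    rw [FormalMultilinearSeries.ofScalars_series_eq_zero]; rfl
  rw [h0] at this
  exact this.eventually_eq_zero

theorem coeff_taylorSeriesZero_of_hasFPowerSeriesAt {c : ℕ → ℝ}
    (h : HasFPowerSeriesAt f (FormalMultilinearSeries.ofScalars ℝ c) 0) (n : ℕ) :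
    PowerSeries.coeff n (taylorSeriesZero f) = c n := by
  have := (hasFPowerSeriesAt_taylorSeriesZero h.analyticAt).eq_formalMultilinearSeries h
  rw [FormalMultilinearSeries.ofScalars_series_eq_iff] at this
  exact congrFun this n

end

/-! ### Bessel's equation and the inversion of the phase. -/

/-- The `n`-th Taylor coefficient of the left side is the recurrence `besselCoeff_succ` at `n`. -/
theorem besselEntire_ode {ν : ℝ} (hν : 0 ≤ ν) : ∀ᶠ w in nhds (0 : ℝ),
    w * deriv (deriv (besselEntire ν)) w + (1 + ν) * deriv (besselEntire ν) w
      + (-(1 + ν)) * besselEntire ν w = 0 := by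
  have a0 := analyticAt_besselEntire hν 0
  have a1 := a0.deriv
  have a2 := a1.deriv
  have ai : AnalyticAt ℝ (fun w : ℝ => w) 0 := analyticAt_id
  have ac : ∀ c : ℝ, AnalyticAt ℝ (fun _ : ℝ => c) 0 := fun c => analyticAt_const
  have hT := coeff_taylorSeriesZero_of_hasFPowerSeriesAt
    (besselEntire_hasFPowerSeriesOnBall hν).hasFPowerSeriesAt
  refine eventually_eq_zero_of_taylorSeriesZero
    (((ai.fun_mul a2).fun_add ((ac _).fun_mul a1)).fun_add ((ac _).fun_mul a0)) ?_
  rw [taylorSeriesZero_add ((ai.fun_mul a2).fun_add ((ac _).fun_mul a1)) ((ac _).fun_mul a0),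
    taylorSeriesZero_add (ai.fun_mul a2) ((ac _).fun_mul a1), taylorSeriesZero_mul ai a2,
    taylorSeriesZero_mul (ac _) a1, taylorSeriesZero_mul (ac _) a0, taylorSeriesZero_id,
    taylorSeriesZero_const, taylorSeriesZero_const]
  ext n
  have h := besselCoeff_succ hν n
  rcases n with _ | n
  · rw [map_add, map_add, PowerSeries.coeff_zero_X_mul, PowerSeries.coeff_C_mul,
      PowerSeries.coeff_C_mul, coeff_taylorSeriesZero_deriv, hT, hT, map_zero]
    push_cast at h ⊢
    linear_combination h
  · rw [map_add, map_add, PowerSeries.coeff_succ_X_mul, PowerSeries.coeff_C_mul,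
      PowerSeries.coeff_C_mul, coeff_taylorSeriesZero_deriv, coeff_taylorSeriesZero_deriv,
      hT, hT, map_zero]
    push_cast at h ⊢
    linear_combination h

/-- Since `E'(0) = 1`, `E` has an analytic local inverse `k`. The function `h(u) = k(exp u)` has
`h(0) = 0` and `h'(0) = 1`, so `h(u)/u` extends analytically with value `1` at `0`, and `p` is its
square root. -/
theorem exists_inversion_profile {ν : ℝ} (hν : 0 ≤ ν) : ∃ p : ℝ → ℝ, AnalyticAt ℝ p 0 ∧ p 0 = 1 ∧
    ∀ᶠ u in nhds (0 : ℝ), besselEntire ν (u * p u ^ 2) = Real.exp u := by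
  have a0 := analyticAt_besselEntire hν 0
  have hd : deriv (besselEntire ν) 0 = 1 := by
    have h := coeff_taylorSeriesZero_of_hasFPowerSeriesAt
      (besselEntire_hasFPowerSeriesOnBall hν).hasFPowerSeriesAt 1
    simpa [taylorSeriesZero, besselCoeff_one hν] using h
  have hd' : deriv (besselEntire ν) 0 ≠ 0 := by rw [hd]; norm_num
  obtain ⟨k, ak, hk1, hkr⟩ : ∃ k : ℝ → ℝ, AnalyticAt ℝ k 1 ∧ k 1 = 0 ∧
      ∀ᶠ y in nhds (1 : ℝ), besselEntire ν (k y) = y := by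
    have h1 := a0.analyticAt_localInverse hd'
    have h2 := HasStrictFDerivAt.localInverse_apply_image
      (a0.hasStrictDerivAt.hasStrictFDerivAt_equiv hd')
    have h3 := HasStrictDerivAt.eventually_right_inverse a0.hasStrictDerivAt hd'
    rw [besselEntire_zero hν] at h1 h2 h3
    exact ⟨_, h1, h2, h3⟩
  have hev := (Real.continuous_exp.tendsto' 0 1 Real.exp_zero).eventually hkr
  obtain ⟨h, hh⟩ : ∃ h : ℝ → ℝ, h = fun u => k (Real.exp u) := ⟨_, rfl⟩
  have ah : AnalyticAt ℝ h 0 := by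
    rw [hh]
    exact AnalyticAt.comp (g := k) (f := Real.exp) (by simpa using ak) analyticAt_rexp
  have h0 : h 0 = 0 := by simp [hh, hk1]
  have hE : (fun u => besselEntire ν (h u)) =ᶠ[nhds 0] Real.exp := by rw [hh]; exact hev
  have hdh : deriv h 0 = 1 := by
    have h1 : HasDerivAt (besselEntire ν) 1 (h 0) := by
      rw [h0, ← hd]; exact a0.differentiableAt.hasDerivAt
    have h2 := h1.comp (0 : ℝ) ah.differentiableAt.hasDerivAt
    have h3 := h2.unique ((Real.hasDerivAt_exp 0).congr_of_eventuallyEq hE)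
    simpa using h3
  have aq : AnalyticAt ℝ (dslope h 0) 0 :=
    (HasFPowerSeriesAt.has_fpower_series_dslope_fslope ah.hasFPowerSeriesAt).analyticAt
  have hq0 : dslope h 0 0 = 1 := by rw [dslope_same, hdh]
  have hqpos : ∀ᶠ u in nhds (0 : ℝ), 0 < dslope h 0 u :=
    aq.continuousAt.eventually (lt_mem_nhds (by rw [hq0]; norm_num))
  refine ⟨fun u => Real.sqrt (dslope h 0 u), ?_, by
      simp only [hq0, Real.sqrt_one], ?_⟩
  · exact ((Real.contDiffAt_sqrt (n := ⊤) (by rw [hq0]; norm_num)).analyticAt).comp aq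
  · filter_upwards [hE, hqpos] with u hu hq
    have : u * Real.sqrt (dslope h 0 u) ^ 2 = h u := by
      rw [Real.sq_sqrt hq.le]
      simpa [h0] using sub_smul_dslope h 0 u
    rw [this]
    exact hu

/-- The derivative of `u p²` is `p g`. Differentiating `E(u p²) = exp u` twice therefore expresses
`E'` and `E''` through `p`, `g` and `exp u`, and Bessel's equation eliminates them. -/
theorem inversion_profile_ode {ν : ℝ} (hν : 0 ≤ ν) {p g : ℝ → ℝ} (hp : AnalyticAt ℝ p 0)
    (hp0 : p 0 = 1) (h : ∀ᶠ u in nhds (0 : ℝ), besselEntire ν (u * p u ^ 2) = Real.exp u)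
    (hg : g = fun u => p u + 2 * u * deriv p u) :
    ∀ᶠ u in nhds (0 : ℝ), u * (p u * g u) + u * (-(p u * deriv g u)) + (1 + ν) * (g u * g u)
      = (g u + -p u) * g u * (1 / 2) + (1 + ν) * (p u * (g u * (g u * g u))) := by
  have aE := analyticAt_besselEntire hν
  have hode := besselEntire_ode hν
  generalize besselEntire ν = E at *
  have hgd : ∀ᶠ u in nhds (0 : ℝ), DifferentiableAt ℝ g u := by
    filter_upwards [hp.eventually_analyticAt] with u hu
    rw [hg]
    exact (hu.add ((analyticAt_const.mul analyticAt_id).mul hu.deriv)).differentiableAt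
  have hd1 : ∀ᶠ u in nhds (0 : ℝ), deriv E (u * p u ^ 2) * (p u * g u) = Real.exp u := by
    have := h.eventually_nhds
    filter_upwards [this, hp.eventually_analyticAt] with u hu hpu
    have h1 : HasDerivAt (fun u => E (u * p u ^ 2)) (deriv E (u * p u ^ 2) * (p u * g u)) u := by
      have h2 : HasDerivAt (fun u => u * p u ^ 2) (p u * g u) u := by
        have := (hasDerivAt_id u).mul (hpu.differentiableAt.hasDerivAt.pow 2)
        refine this.congr_deriv ?_
        simp [hg]; ring
      exact (aE _).differentiableAt.hasDerivAt.comp u h2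
    exact h1.unique ((Real.hasDerivAt_exp u).congr_of_eventuallyEq hu)
  have hd2 : ∀ᶠ u in nhds (0 : ℝ), deriv (deriv E) (u * p u ^ 2) * (p u * g u) * (p u * g u)
      + deriv E (u * p u ^ 2) * (deriv p u * g u + p u * deriv g u) = Real.exp u := by
    have := hd1.eventually_nhds
    filter_upwards [this, hp.eventually_analyticAt, hgd] with u hu hpu hgu
    have h1 : HasDerivAt (fun u => deriv E (u * p u ^ 2))
        (deriv (deriv E) (u * p u ^ 2) * (p u * g u)) u := by
      have h2 : HasDerivAt (fun u => u * p u ^ 2) (p u * g u) u := by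
        have := (hasDerivAt_id u).mul (hpu.differentiableAt.hasDerivAt.pow 2)
        refine this.congr_deriv ?_
        simp [hg]; ring
      exact (aE _).deriv.differentiableAt.hasDerivAt.comp u h2
    have h3 := h1.mul (hpu.differentiableAt.hasDerivAt.mul hgu.hasDerivAt)
    exact h3.unique ((Real.hasDerivAt_exp u).congr_of_eventuallyEq hu)
  have hcont : Tendsto (fun u => u * p u ^ 2) (nhds 0) (nhds 0) := by
    have : ContinuousAt (fun u => u * p u ^ 2) 0 := continuousAt_id.mul (hp.continuousAt.pow 2)
    simpa [ContinuousAt] using this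
  have hode' := hcont.eventually hode
  have hppos : ∀ᶠ u in nhds (0 : ℝ), 0 < p u :=
    hp.continuousAt.eventually (lt_mem_nhds (by rw [hp0]; norm_num))
  filter_upwards [h, hd1, hd2, hode', hppos] with u e0 e1 e2 e3 hpu
  have hgu : g u = p u + 2 * u * deriv p u := by rw [hg]
  have hne : Real.exp u * p u ^ 2 ≠ 0 := by positivity
  rw [e0] at e3
  generalize deriv (deriv E) (u * p u ^ 2) = E2 at *
  generalize deriv E (u * p u ^ 2) = E1 at *
  generalize deriv g u = g' at *
  generalize deriv p u = p' at *
  generalize Real.exp u = e at *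
  generalize g u = G at *
  generalize p u = P at *
  apply mul_left_cancel₀ hne
  -- Bessel's equation times `(pg)³`, with `E'` and `E''` substituted. The remaining `p'` is then
  -- removed through `2up' = g - p`, which leaves the goal times `exp u · p²`.
  have key : u * P ^ 2 * (P * G * e - e * (p' * G + P * g')) + (1 + ν) * e * (P * G) ^ 2
      = (1 + ν) * e * (P * G) ^ 3 := by
    linear_combination (P * G) ^ 3 * e3 - u * P ^ 2 * (P * G) * e2
      + (u * P ^ 2 * (p' * G + P * g') - (1 + ν) * (P * G) ^ 2) * e1
  have hp' : u * p' = (G - P) / 2 := by rw [hgu]; ring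
  linear_combination key + (e * P ^ 2 * G) * hp'

/-! ### The recursion for the coefficients. -/

theorem inversion_profile_taylorSeriesZero {p g : ℝ → ℝ} (hp : AnalyticAt ℝ p 0)
    (hg : g = fun u => p u + 2 * u * deriv p u) (n : ℕ) :
    PowerSeries.coeff n (taylorSeriesZero g)
      = (2 * n + 1) * PowerSeries.coeff n (taylorSeriesZero p) := by
  have hg' : g = fun u => p u + 2 * (u * deriv p u) := by
    rw [hg]; funext u; ring
  have ai : AnalyticAt ℝ (fun w : ℝ => w) 0 := analyticAt_id
  have ac : AnalyticAt ℝ (fun _ : ℝ => (2 : ℝ)) 0 := analyticAt_const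
  rw [hg', taylorSeriesZero_add hp (ac.fun_mul (ai.fun_mul hp.deriv)),
    taylorSeriesZero_mul ac (ai.fun_mul hp.deriv), taylorSeriesZero_mul ai hp.deriv,
    taylorSeriesZero_const, taylorSeriesZero_id, map_add, PowerSeries.coeff_C_mul]
  rcases n with _ | n
  · rw [PowerSeries.coeff_zero_X_mul]; push_cast; ring
  · rw [PowerSeries.coeff_succ_X_mul, coeff_taylorSeriesZero_deriv]; push_cast; ring

/-- Differences are written with a factor `-1`, so that the rules for sums, products and constants
suffice. -/
theorem taylorSeriesZero_inversion_profile_ode {ν : ℝ} {p g : ℝ → ℝ} (hp : AnalyticAt ℝ p 0)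
    (hg : AnalyticAt ℝ g 0)
    (h : ∀ᶠ u in nhds (0 : ℝ), u * (p u * g u) + u * (-1 * (p u * deriv g u))
        + (1 + ν) * (g u * g u)
      = (g u + -1 * p u) * g u * (1 / 2) + (1 + ν) * (p u * (g u * (g u * g u)))) :
    PowerSeries.X * (taylorSeriesZero p * taylorSeriesZero g)
      + PowerSeries.X * (PowerSeries.C (-1) * (taylorSeriesZero p * taylorSeriesZero (deriv g)))
      + PowerSeries.C (1 + ν) * (taylorSeriesZero g * taylorSeriesZero g)
    = (taylorSeriesZero g + PowerSeries.C (-1) * taylorSeriesZero p) * taylorSeriesZero g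
        * PowerSeries.C (1 / 2)
      + PowerSeries.C (1 + ν) * (taylorSeriesZero p *
        (taylorSeriesZero g * (taylorSeriesZero g * taylorSeriesZero g))) := by
  have ai : AnalyticAt ℝ (fun w : ℝ => w) 0 := analyticAt_id
  have ac : ∀ c : ℝ, AnalyticAt ℝ (fun _ : ℝ => c) 0 := fun c => analyticAt_const
  have hd := hg.deriv
  have h1 := taylorSeriesZero_congr h
  have a1 := ai.fun_mul (hp.fun_mul hg)
  have a2 := ai.fun_mul ((ac (-1)).fun_mul (hp.fun_mul hd))
  have a3 := (ac (1 + ν)).fun_mul (hg.fun_mul hg)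
  have a4 := (hg.fun_add ((ac (-1)).fun_mul hp)).fun_mul hg
  have a5 := hp.fun_mul (hg.fun_mul (hg.fun_mul hg))
  rw [taylorSeriesZero_add (a1.fun_add a2) a3, taylorSeriesZero_add a1 a2,
    taylorSeriesZero_mul ai (hp.fun_mul hg), taylorSeriesZero_mul hp hg,
    taylorSeriesZero_mul ai ((ac (-1)).fun_mul (hp.fun_mul hd)),
    taylorSeriesZero_mul (ac (-1)) (hp.fun_mul hd), taylorSeriesZero_mul hp hd,
    taylorSeriesZero_mul (ac (1 + ν)) (hg.fun_mul hg), taylorSeriesZero_mul hg hg,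
    taylorSeriesZero_add (a4.fun_mul (ac (1 / 2))) ((ac (1 + ν)).fun_mul a5),
    taylorSeriesZero_mul a4 (ac (1 / 2)),
    taylorSeriesZero_mul (hg.fun_add ((ac (-1)).fun_mul hp)) hg,
    taylorSeriesZero_add hg ((ac (-1)).fun_mul hp),
    taylorSeriesZero_mul (ac (-1)) hp,
    taylorSeriesZero_mul (ac (1 + ν)) a5,
    taylorSeriesZero_mul hp (hg.fun_mul (hg.fun_mul hg)),
    taylorSeriesZero_mul hg (hg.fun_mul hg), taylorSeriesZero_mul hg hg,
    taylorSeriesZero_const, taylorSeriesZero_const, taylorSeriesZero_const,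
    taylorSeriesZero_id] at h1
  exact h1

theorem inversion_coeff_values {ν : ℝ} (hν : 0 ≤ ν) {P G D : PowerSeries ℝ} {A : ℕ → ℝ}
    (hG : ∀ n, PowerSeries.coeff n G = A n)
    (hP : ∀ n, PowerSeries.coeff n P = A n / (2 * n + 1))
    (hD : ∀ n : ℕ, PowerSeries.coeff n D = (n + 1) * A (n + 1)) (h0 : A 0 = 1)
    (h : PowerSeries.X * (P * G) + PowerSeries.X * (PowerSeries.C (-1) * (P * D))
      + PowerSeries.C (1 + ν) * (G * G)
      = (G + PowerSeries.C (-1) * P) * G * PowerSeries.C (1 / 2)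
        + PowerSeries.C (1 + ν) * (P * (G * (G * G)))) :
    A 1 = 3 / (4 * (2 + ν)) ∧
    A 2 = -(5 * (1 + 11 * ν)) / (96 * (2 + ν) ^ 2 * (3 + ν)) ∧
    A 3 = -(7 * (20 + 9 * ν - 17 * ν ^ 2)) / (128 * (2 + ν) ^ 3 * (3 + ν) * (4 + ν)) ∧
    A 4 = (75404 + 262439 * ν + 182205 * ν ^ 2 - 28031 * ν ^ 3 - 19409 * ν ^ 4) /
      (10240 * (2 + ν) ^ 4 * (3 + ν) ^ 2 * (4 + ν) * (5 + ν)) ∧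
    A 5 = 11 * (127864 - 364742 * ν - 1417421 * ν ^ 2 - 966731 * ν ^ 3 + 8605 * ν ^ 4
        + 48361 * ν ^ 5) /
      (122880 * (2 + ν) ^ 5 * (3 + ν) ^ 2 * (4 + ν) * (5 + ν) * (6 + ν)) := by
  -- The constant coefficient holds trivially for `A 0 = 1`, hence the shift. With `m = n + 1`, the
  -- coefficient of `X^m` is linear in `A m`, with factor `-(2m+2)/(2m+1) · (m+1+ν)`. This explains
  -- the multipliers `5/6`, `7/8`, `9/10`, `11/12` below and the new denominator factor at each
  -- stage.
  have e : ∀ n : ℕ, _ := fun n => congrArg (PowerSeries.coeff (n + 1)) h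
  simp only [map_add, PowerSeries.coeff_succ_X_mul, PowerSeries.coeff_C_mul,
    PowerSeries.coeff_mul_C] at e
  simp only [PowerSeries.coeff_mul, map_add, hG, hP, hD] at e
  have b2 : 2 + ν ≠ 0 := by linarith
  have b3 : 3 + ν ≠ 0 := by linarith
  have b4 : 4 + ν ≠ 0 := by linarith
  have b5 : 5 + ν ≠ 0 := by linarith
  have b6 : 6 + ν ≠ 0 := by linarith
  have h1 : A 1 = 3 / (4 * (2 + ν)) := by
    have e0 := e 0
    simp [Finset.Nat.antidiagonal_succ, h0] at e0
    rw [eq_div_iff (by positivity)]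
    linear_combination -3 * e0
  have h2 : A 2 = -(5 * (1 + 11 * ν)) / (96 * (2 + ν) ^ 2 * (3 + ν)) := by
    have e0 : (3 + ν) * A 2 = 5 / 6 * (4 / 3 * A 1 - 2 / 3 * A 1 ^ 2
      + (1 + ν) * (- 3 * A 1 ^ 2)) := by
      have e0 := e 1
      simp [Finset.Nat.antidiagonal_succ, h0] at e0
      linear_combination -(5 / 6) * e0
    apply mul_left_cancel₀ b3
    rw [e0, h1]
    field_simp
    ring
  have h3 : A 3 = -(7 * (20 + 9 * ν - 17 * ν ^ 2)) / (128 * (2 + ν) ^ 3 * (3 + ν) * (4 + ν)) := by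
    have e0 : (4 + ν) * A 3 = 7 / 8 * (1 / 3 * A 1 ^ 2 - 8 / 5 * A 1 * A 2 + 6 / 5 * A 2
      + (1 + ν) * (- 2 * A 1 ^ 3 - 28 / 5 * A 1 * A 2)) := by
      have e0 := e 2
      simp [Finset.Nat.antidiagonal_succ, h0] at e0
      linear_combination -(7 / 8) * e0
    apply mul_left_cancel₀ b4
    rw [e0, h2, h1]
    field_simp
    ring
  have h4 : A 4 = (75404 + 262439 * ν + 182205 * ν ^ 2 - 28031 * ν ^ 3 - 19409 * ν ^ 4) /
      (10240 * (2 + ν) ^ 4 * (3 + ν) ^ 2 * (4 + ν) * (5 + ν)) := by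
    have e0 : (5 + ν) * A 4 = 9 / 10 * (8 / 15 * A 1 * A 2 - 40 / 21 * A 1 * A 3 - 4 / 5 * A 2 ^ 2 + 8 / 7 * A 3
      + (1 + ν) * (- 1 / 3 * A 1 ^ 4 - 28 / 5 * A 1 ^ 2 * A 2 - 38 / 7 * A 1 * A 3
      - 13 / 5 * A 2 ^ 2)) := by
      have e0 := e 3
      simp [Finset.Nat.antidiagonal_succ, h0] at e0
      linear_combination -(9 / 10) * e0
    apply mul_left_cancel₀ b5
    rw [e0, h3, h2, h1]
    field_simp
    ring
  have h5 : A 5 = 11 * (127864 - 364742 * ν - 1417421 * ν ^ 2 - 966731 * ν ^ 3 + 8605 * ν ^ 4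
        + 48361 * ν ^ 5) /
      (122880 * (2 + ν) ^ 5 * (3 + ν) ^ 2 * (4 + ν) * (5 + ν) * (6 + ν)) := by
    have e0 : (6 + ν) * A 5 = 11 / 12 * (10 / 21 * A 1 * A 3 - 20 / 9 * A 1 * A 4 + 1 / 5 * A 2 ^ 2
      - 12 / 7 * A 2 * A 3 + 10 / 9 * A 4
      + (1 + ν) * (- 6 / 5 * A 1 ^ 3 * A 2 - 38 / 7 * A 1 ^ 2 * A 3
      - 26 / 5 * A 1 * A 2 ^ 2 - 16 / 3 * A 1 * A 4 - 176 / 35 * A 2 * A 3)) := by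
      have e0 := e 4
      simp [Finset.Nat.antidiagonal_succ, h0] at e0
      linear_combination -(11 / 12) * e0
    apply mul_left_cancel₀ b6
    rw [e0, h4, h3, h2, h1]
    field_simp
    ring
  exact ⟨h1, h2, h3, h4, h5⟩

/-! ### Convergence of the integral and its tail. -/

theorem continuous_besselEntire_sq_rpow {ν : ℝ} (hν : 0 ≤ ν) (n : ℝ) :
    Continuous fun x : ℝ => besselEntire ν (x ^ 2 / (4 * (1 + ν))) ^ (-n) := by
  refine Continuous.rpow_const ((continuous_besselEntire hν).comp (by fun_prop)) fun x => Or.inl ?_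
  have := one_le_besselEntire hν (w := x ^ 2 / (4 * (1 + ν))) (by positivity)
  linarith

theorem integrableOn_besselEntire_sq_rpow {ν : ℝ} (hν : 0 ≤ ν) {n : ℝ} (hn : 0 < n) :
    IntegrableOn (fun x : ℝ => besselEntire ν (x ^ 2 / (4 * (1 + ν))) ^ (-n)) (Ioi 0) := by
  have hc := continuous_besselEntire_sq_rpow hν n
  rw [← Ioc_union_Ioi_eq_Ioi (zero_le_one (α := ℝ))]
  refine IntegrableOn.union ((hc.integrableOn_Icc (a := 0) (b := 1)).mono_set Ioc_subset_Icc_self) ?_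
  -- A single term `c_m w^m ≤ E(w)` bounds the integrand by a multiple of `x^(-2mn)`, integrable on
  -- `(1, ∞)` once `2mn > 1`.
  obtain ⟨m, hm⟩ := exists_nat_gt (1 / (2 * n))
  have hm' : 1 < 2 * m * n := by
    rw [div_lt_iff₀ (by positivity)] at hm; linarith
  have hcm := besselCoeff_pos hν m
  have hν' : 0 < 4 * (1 + ν) := by linarith
  have hK : 0 < besselCoeff ν m / (4 * (1 + ν)) ^ m := by positivity
  have hint : IntegrableOn (fun x : ℝ => (besselCoeff ν m / (4 * (1 + ν)) ^ m) ^ (-n)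
      * x ^ (-(2 * m * n))) (Ioi 1) :=
    (integrableOn_Ioi_rpow_of_lt (by linarith) one_pos).const_mul _
  refine hint.mono' hc.aestronglyMeasurable ?_
  filter_upwards [ae_restrict_mem measurableSet_Ioi] with x hx
  have hx0 : (0 : ℝ) < x := zero_lt_one.trans hx
  have h1 := le_besselEntire hν (w := x ^ 2 / (4 * (1 + ν))) (by positivity) m
  have h2 : besselCoeff ν m * (x ^ 2 / (4 * (1 + ν))) ^ m
      = besselCoeff ν m / (4 * (1 + ν)) ^ m * x ^ (2 * (m : ℝ)) := by
    rw [Real.rpow_mul hx0.le, Real.rpow_natCast, div_pow]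
    norm_num
    ring
  have hpos : 0 < besselCoeff ν m / (4 * (1 + ν)) ^ m * x ^ (2 * (m : ℝ)) := by positivity
  rw [h2] at h1
  rw [Real.norm_of_nonneg (Real.rpow_nonneg (hpos.le.trans h1) _)]
  refine (Real.rpow_le_rpow_of_nonpos hpos h1 (by linarith)).trans_eq ?_
  rw [Real.mul_rpow hK.le (by positivity), ← Real.rpow_mul hx0.le]
  ring_nf

theorem besselIntegrand_eq {ν : ℝ} (hν : 0 ≤ ν) (n : ℝ) {x : ℝ} (hx : 0 < x) :
    besselIntegrand ν n x = besselEntire ν (x ^ 2 / (4 * (1 + ν))) ^ (-n) := by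
  rw [besselIntegrand, besselINorm_eq hν hx]

theorem integrableOn_besselIntegrand {ν : ℝ} (hν : 0 ≤ ν) {n : ℝ} (hn : 0 < n) :
    IntegrableOn (besselIntegrand ν n) (Ioi 0) :=
  (integrableOn_besselEntire_sq_rpow hν hn).congr_fun
    (fun _ hx => (besselIntegrand_eq hν n hx).symm) measurableSet_Ioi

theorem besselIntegral_tail_isBigO {ν : ℝ} (hν : 0 ≤ ν) {δ : ℝ} (hδ : 0 < δ) (s : ℝ) :
    (fun n : ℝ => ∫ x in Ioi δ, besselEntire ν (x ^ 2 / (4 * (1 + ν))) ^ (-n))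
      =O[atTop] fun n : ℝ => 1 / n ^ s := by
  have hν' : 0 < 4 * (1 + ν) := by linarith
  set b := besselEntire ν (δ ^ 2 / (4 * (1 + ν))) with hb
  have hb1 : 1 < b := one_lt_besselEntire hν (by positivity)
  have hb0 : 0 < b := by linarith
  have hlog : 0 < Real.log b := Real.log_pos hb1
  have hint := (integrableOn_besselEntire_sq_rpow hν one_pos).mono_set (Ioi_subset_Ioi hδ.le)
  have hO : (fun n : ℝ => ∫ x in Ioi δ, besselEntire ν (x ^ 2 / (4 * (1 + ν))) ^ (-n))
      =O[atTop] fun n : ℝ => Real.exp (-Real.log b * n) := by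
    refine IsBigO.of_bound
      (b * ∫ x in Ioi δ, besselEntire ν (x ^ 2 / (4 * (1 + ν))) ^ (-(1 : ℝ))) ?_
    filter_upwards [eventually_ge_atTop 1] with n hn
    have hle := norm_integral_le_of_norm_le (hint.const_mul (b ^ (-(n - 1))))
      (f := fun x : ℝ => besselEntire ν (x ^ 2 / (4 * (1 + ν))) ^ (-n)) (by
        filter_upwards [ae_restrict_mem measurableSet_Ioi] with x hx
        have hx' : δ ^ 2 / (4 * (1 + ν)) ≤ x ^ 2 / (4 * (1 + ν)) := by
          have : δ < x := hx
          gcongr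
        have hbx := besselEntire_mono hν (by positivity) hx'
        have hx0 := hb0.trans_le hbx
        rw [Real.norm_of_nonneg (Real.rpow_nonneg hx0.le _)]
        -- One power of `E⁻¹` is kept for integrability; the other `n - 1` are bounded by `b⁻¹ < 1`
        -- each, giving exponential decay.
        have hsplit : -n = -(n - 1) + -1 := by ring
        rw [hsplit, Real.rpow_add hx0]
        exact mul_le_mul_of_nonneg_right
          (Real.rpow_le_rpow_of_nonpos hb0 hbx (by linarith)) (Real.rpow_nonneg hx0.le _))
    refine hle.trans_eq ?_
    rw [integral_const_mul, Real.norm_of_nonneg (Real.exp_pos _).le,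
      show -Real.log b * n = Real.log b * (-n) by ring, ← Real.rpow_def_of_pos hb0,
      show -(n - 1) = 1 + -n by ring, Real.rpow_add hb0, Real.rpow_one]
    ring
  refine (hO.trans (isLittleO_exp_neg_mul_rpow_atTop hlog (-s)).isBigO).congr' .rfl ?_
  filter_upwards [eventually_gt_atTop 0] with n hn
  rw [Real.rpow_neg hn.le, one_div]

/-! ### Watson's lemma for even expansions. -/

theorem integrableOn_pow_mul_exp_neg_mul_sq (k : ℕ) {n : ℝ} (hn : 0 < n) :
    IntegrableOn (fun t : ℝ => t ^ (2 * k) * Real.exp (-n * t ^ 2)) (Ioi 0) := by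
  have h := integrableOn_rpow_mul_exp_neg_mul_sq hn (s := ((2 * k : ℕ) : ℝ))
    (by have := (2 * k).cast_nonneg (α := ℝ); linarith)
  simpa only [Real.rpow_natCast] using h

theorem integral_pow_mul_exp_neg_mul_sq (k : ℕ) {n : ℝ} (hn : 0 < n) :
    ∫ t in Ioi (0 : ℝ), t ^ (2 * k) * Real.exp (-n * t ^ 2)
      = 1 / 2 * (Real.Gamma (k + 1 / 2) / n ^ ((k : ℝ) + 1 / 2)) := by
  have h := integral_rpow_mul_exp_neg_mul_rpow (p := 2) (q := ((2 * k : ℕ) : ℝ)) two_pos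
    (by have := (2 * k).cast_nonneg (α := ℝ); linarith) hn
  simp only [Real.rpow_natCast, Real.rpow_ofNat] at h
  rw [h]
  have h1 : (((2 * k : ℕ) : ℝ) + 1) / 2 = k + 1 / 2 := by push_cast; ring
  rw [neg_div, h1, Real.rpow_neg hn.le]
  field_simp

/-- Extending `G` by zero beyond `T` preserves a remainder bound of order `t^(2N)`, because `t^(2k)
≤ T^(2k-2N) t^(2N)` for `t > T` and `k < N`. Everything is then integrated over the whole half-line,
where the Gaussian moments are exact and no truncated tails need estimating. -/
theorem watson_even_isBigO {G : ℝ → ℝ} {A : ℕ → ℝ} {N : ℕ} {T C : ℝ} (hT : 0 < T)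
    (hG : ContinuousOn G (Icc 0 T))
    (hbound : ∀ t ∈ Ioc 0 T, |G t - ∑ k ∈ Finset.range N, A k * t ^ (2 * k)| ≤ C * t ^ (2 * N)) :
    (fun n : ℝ => (∫ t in Ioc 0 T, Real.exp (-n * t ^ 2) * G t)
      - 1 / 2 * ∑ k ∈ Finset.range N, A k * Real.Gamma (k + 1 / 2) / n ^ ((k : ℝ) + 1 / 2))
      =O[atTop] fun n : ℝ => 1 / n ^ ((N : ℝ) + 1 / 2) := by
  set C' : ℝ := |C| + ∑ k ∈ Finset.range N, |A k| * T ^ (2 * k) / T ^ (2 * N) with hC'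
  have hS0 : 0 ≤ ∑ k ∈ Finset.range N, |A k| * T ^ (2 * k) / T ^ (2 * N) :=
    Finset.sum_nonneg fun k _ => by positivity
  have hb : ∀ t ∈ Ioi (0 : ℝ), |(Ioc 0 T).indicator G t
      - ∑ k ∈ Finset.range N, A k * t ^ (2 * k)| ≤ C' * t ^ (2 * N) := by
    intro t ht
    have ht0 : (0 : ℝ) < t := ht
    by_cases h : t ∈ Ioc 0 T
    · rw [indicator_of_mem h]
      refine (hbound t h).trans (mul_le_mul_of_nonneg_right ?_ (by positivity))
      have := le_abs_self C
      linarith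
    · rw [indicator_of_notMem h, zero_sub, abs_neg]
      have hTt : T < t := by
        by_contra hcon
        exact h ⟨ht0, not_lt.1 hcon⟩
      refine (Finset.abs_sum_le_sum_abs _ _).trans ?_
      have h1 : ∑ k ∈ Finset.range N, |A k * t ^ (2 * k)|
          ≤ (∑ k ∈ Finset.range N, |A k| * T ^ (2 * k) / T ^ (2 * N)) * t ^ (2 * N) := by
        rw [Finset.sum_mul]
        refine Finset.sum_le_sum fun k hk => ?_
        have hk' : 2 * N = 2 * k + 2 * (N - k) := by
          have := Finset.mem_range.1 hk; omega
        rw [abs_mul, abs_of_pos (by positivity : 0 < t ^ (2 * k)), div_mul_eq_mul_div,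
          le_div_iff₀ (by positivity), hk', pow_add, pow_add]
        have : T ^ (2 * (N - k)) ≤ t ^ (2 * (N - k)) := pow_le_pow_left₀ hT.le hTt.le _
        have h3 : 0 ≤ |A k| * t ^ (2 * k) * T ^ (2 * k) := by positivity
        nlinarith [mul_le_mul_of_nonneg_left this h3]
      refine h1.trans (mul_le_mul_of_nonneg_right ?_ (by positivity))
      have := abs_nonneg C
      linarith
  refine IsBigO.of_bound (C' * (1 / 2 * Real.Gamma (N + 1 / 2))) ?_
  filter_upwards [eventually_gt_atTop 0] with n hn
  have hint1 : IntegrableOn (fun t => (Ioc 0 T).indicator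
      (fun t => Real.exp (-n * t ^ 2) * G t) t) (Ioi 0) := by
    refine Integrable.integrableOn ?_
    rw [integrable_indicator_iff measurableSet_Ioc]
    refine IntegrableOn.mono_set (t := Icc 0 T) ?_ Ioc_subset_Icc_self
    refine ContinuousOn.integrableOn_Icc (ContinuousOn.mul ?_ hG)
    exact Continuous.continuousOn (by fun_prop)
  have hint2 : ∀ k ∈ Finset.range N, Integrable
      (fun t : ℝ => A k * (t ^ (2 * k) * Real.exp (-n * t ^ 2))) (volume.restrict (Ioi 0)) :=
    fun k _ => (integrableOn_pow_mul_exp_neg_mul_sq k hn).const_mul _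
  have heq : (∫ t in Ioc 0 T, Real.exp (-n * t ^ 2) * G t)
      - 1 / 2 * ∑ k ∈ Finset.range N, A k * Real.Gamma (k + 1 / 2) / n ^ ((k : ℝ) + 1 / 2)
      = ∫ t in Ioi (0 : ℝ), ((Ioc 0 T).indicator (fun t => Real.exp (-n * t ^ 2) * G t) t
        - ∑ k ∈ Finset.range N, A k * (t ^ (2 * k) * Real.exp (-n * t ^ 2))) := by
    rw [integral_sub hint1 (integrable_finsetSum _ hint2), integral_finsetSum _ hint2,
      setIntegral_indicator measurableSet_Ioc, inter_eq_right.2 Ioc_subset_Ioi_self,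
      Finset.mul_sum]
    congr 1
    refine Finset.sum_congr rfl fun k _ => ?_
    rw [integral_const_mul, integral_pow_mul_exp_neg_mul_sq k hn]
    ring
  rw [heq]
  refine (norm_integral_le_of_norm_le
    ((integrableOn_pow_mul_exp_neg_mul_sq N hn).const_mul C') ?_).trans_eq ?_
  · filter_upwards [ae_restrict_mem measurableSet_Ioi] with t ht
    have h1 : (Ioc 0 T).indicator (fun t => Real.exp (-n * t ^ 2) * G t) t
        - ∑ k ∈ Finset.range N, A k * (t ^ (2 * k) * Real.exp (-n * t ^ 2))
        = ((Ioc 0 T).indicator G t - ∑ k ∈ Finset.range N, A k * t ^ (2 * k))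
          * Real.exp (-n * t ^ 2) := by
      rw [sub_mul, Finset.sum_mul]
      congr 1
      · by_cases h : t ∈ Ioc 0 T
        · rw [indicator_of_mem h, indicator_of_mem h, mul_comm]
        · rw [indicator_of_notMem h, indicator_of_notMem h, zero_mul]
      · exact Finset.sum_congr rfl fun k _ => by ring
    rw [h1, norm_mul, Real.norm_of_nonneg (Real.exp_pos _).le, ← mul_assoc]
    exact mul_le_mul_of_nonneg_right (hb t ht) (Real.exp_pos _).le
  · rw [integral_const_mul, integral_pow_mul_exp_neg_mul_sq N hn, Real.norm_of_nonneg (by positivity)]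
    ring

/-! ### The change of variable and the final assembly. -/

theorem hasDerivAt_inversion_map {p : ℝ → ℝ} (S : ℝ) {t : ℝ} (hp : DifferentiableAt ℝ p (t ^ 2)) :
    HasDerivAt (fun t => S * (t * p (t ^ 2)))
      (S * (p (t ^ 2) + 2 * t ^ 2 * deriv p (t ^ 2))) t := by
  have h1 : HasDerivAt (fun t : ℝ => p (t ^ 2)) (deriv p (t ^ 2) * (2 * t)) t := by
    have := HasDerivAt.comp (h₂ := p) (h := fun t : ℝ => t ^ 2) t hp.hasDerivAt (hasDerivAt_pow 2 t)
    refine this.congr_deriv ?_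
    simp
  refine (((hasDerivAt_id t).mul h1).const_mul S).congr_deriv ?_
  simp only [id]
  ring

theorem besselIntegral_isBigO {ν : ℝ} (hν : 0 ≤ ν) {p g : ℝ → ℝ} (hp : AnalyticAt ℝ p 0)
    (hp0 : p 0 = 1) (h : ∀ᶠ u in nhds (0 : ℝ), besselEntire ν (u * p u ^ 2) = Real.exp u)
    (hg : g = fun u => p u + 2 * u * deriv p u) (ga : AnalyticAt ℝ g 0) (N : ℕ) :
    (fun n : ℝ => besselIntegral ν n - (1 + ν) ^ (1 / 2 : ℝ) *
        ∑ k ∈ Finset.range N, PowerSeries.coeff k (taylorSeriesZero g) * Real.Gamma (k + 1 / 2)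
          / n ^ ((k : ℝ) + 1 / 2))
      =O[atTop] fun n : ℝ => 1 / n ^ ((N : ℝ) + 1 / 2) := by
  set A : ℕ → ℝ := fun k => PowerSeries.coeff k (taylorSeriesZero g)
  have hν1 : 0 < 1 + ν := by linarith
  have hppos : ∀ᶠ u in nhds (0 : ℝ), 0 < p u :=
    hp.continuousAt.eventually (lt_mem_nhds (by rw [hp0]; norm_num))
  obtain ⟨C, hC⟩ := ((hasFPowerSeriesAt_taylorSeriesZero ga).isBigO_sub_partialSum_pow N).bound
  obtain ⟨r, hr, hball⟩ := Metric.eventually_nhds_iff.1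
    (h.and (hppos.and (hp.eventually_analyticAt.and (ga.eventually_analyticAt.and hC))))
  obtain ⟨T, hT, hTr⟩ : ∃ T : ℝ, 0 < T ∧ T ^ 2 < r := by
    have h1 := ((continuous_pow 2).tendsto' (0 : ℝ) 0 (by norm_num)).eventually (gt_mem_nhds hr)
    obtain ⟨ε, hε, hh⟩ := Metric.eventually_nhds_iff.1 h1
    refine ⟨ε / 2, by positivity, hh ?_⟩
    rw [Real.dist_eq, sub_zero, abs_of_pos (by positivity)]
    linarith
  have hsq : ∀ t ∈ Icc 0 T, dist (t ^ 2) 0 < r := by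
    intro t ht
    rw [Real.dist_eq, sub_zero, abs_of_nonneg (sq_nonneg t)]
    exact (pow_le_pow_left₀ ht.1 ht.2 2).trans_lt hTr
  set S : ℝ := 2 * Real.sqrt (1 + ν) with hS
  have hSpos : 0 < S := by positivity
  have hS2 : S ^ 2 = 4 * (1 + ν) := by rw [hS, mul_pow, Real.sq_sqrt hν1.le]; norm_num
  set X : ℝ → ℝ := fun t => S * (t * p (t ^ 2)) with hX
  have hXd : ∀ t ∈ Icc 0 T, HasDerivAt X (S * g (t ^ 2)) t := by
    intro t ht
    have := hasDerivAt_inversion_map S (hball (hsq t ht)).2.2.1.differentiableAt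
    rw [hg]
    exact this
  have hgc : ContinuousOn (fun t => g (t ^ 2)) (Icc 0 T) := by
    intro t ht
    exact (ContinuousAt.comp (g := g) (f := fun t : ℝ => t ^ 2)
      (hball (hsq t ht)).2.2.2.1.continuousAt (by fun_prop)).continuousWithinAt
  have hδ : 0 < X T :=
    mul_pos hSpos (mul_pos hT (hball (hsq T ⟨hT.le, le_rfl⟩)).2.1)
  have hbound : ∀ t ∈ Ioc 0 T, |g (t ^ 2) - ∑ k ∈ Finset.range N, A k * t ^ (2 * k)|
      ≤ C * t ^ (2 * N) := by
    intro t ht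
    have h1 := (hball (hsq t ⟨ht.1.le, ht.2⟩)).2.2.2.2
    simp only [zero_add, FormalMultilinearSeries.partialSum,
      FormalMultilinearSeries.ofScalars_apply_eq, smul_eq_mul, Real.norm_eq_abs,
      abs_of_nonneg (sq_nonneg t), abs_pow, ← pow_mul, abs_of_pos ht.1] at h1
    exact h1
  have hmain := (watson_even_isBigO hT hgc hbound).const_mul_left S
  have htail := besselIntegral_tail_isBigO hν hδ ((N : ℝ) + 1 / 2)
  refine (hmain.add htail).congr' ?_ .rfl
  filter_upwards [eventually_gt_atTop 0] with n hn
  have hcov : ∫ x in Ioc 0 (X T), besselEntire ν (x ^ 2 / (4 * (1 + ν))) ^ (-n)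
      = S * ∫ t in Ioc 0 T, Real.exp (-n * t ^ 2) * g (t ^ 2) := by
    have hX0 : X 0 = 0 := by simp [hX]
    -- In this oriented form of substitution only the endpoints `X 0 = 0` and `X T` matter;
    -- injectivity of `X` is not needed.
    have h1 := intervalIntegral.integral_comp_mul_deriv (a := 0) (b := T) (f := X)
      (f' := fun t => S * g (t ^ 2)) (by rw [uIcc_of_le hT.le]; exact hXd)
      (by rw [uIcc_of_le hT.le]; exact continuousOn_const.mul hgc)
      (continuous_besselEntire_sq_rpow hν n)
    rw [hX0, intervalIntegral.integral_of_le hδ.le, intervalIntegral.integral_of_le hT.le] at h1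
    rw [← h1, ← integral_const_mul]
    refine setIntegral_congr_fun measurableSet_Ioc fun t ht => ?_
    have h2 : X t ^ 2 / (4 * (1 + ν)) = t ^ 2 * p (t ^ 2) ^ 2 := by
      rw [← hS2, hX]; field_simp
    simp only [Function.comp]
    rw [h2, (hball (hsq t ⟨ht.1.le, ht.2⟩)).1, ← Real.exp_mul]
    ring_nf
  have hsplit : besselIntegral ν n
      = (∫ x in Ioc 0 (X T), besselEntire ν (x ^ 2 / (4 * (1 + ν))) ^ (-n))
        + ∫ x in Ioi (X T), besselEntire ν (x ^ 2 / (4 * (1 + ν))) ^ (-n) := by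
    have hi := integrableOn_besselEntire_sq_rpow hν hn
    rw [besselIntegral, setIntegral_congr_fun measurableSet_Ioi
      (fun x hx => besselIntegrand_eq hν n hx), ← Ioc_union_Ioi_eq_Ioi hδ.le,
      setIntegral_union (Ioc_disjoint_Ioi le_rfl) measurableSet_Ioi
        (hi.mono_set Ioc_subset_Ioi_self) (hi.mono_set (Ioi_subset_Ioi hδ.le))]
  -- The `2` in `S = 2√(1+ν)` cancels the `1/2` of the Gaussian moments.
  rw [hsplit, hcov, ← Real.sqrt_eq_rpow, hS]
  ring

theorem isInversionCoeff_taylorSeriesZero {ν : ℝ} (hν : 0 ≤ ν) {p g : ℝ → ℝ}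
    (hp : AnalyticAt ℝ p 0) (hp0 : p 0 = 1)
    (h : ∀ᶠ u in nhds (0 : ℝ), besselEntire ν (u * p u ^ 2) = Real.exp u)
    (hg : g = fun u => p u + 2 * u * deriv p u) (ga : AnalyticAt ℝ g 0) :
    IsInversionCoeff ν fun k => PowerSeries.coeff k (taylorSeriesZero g) := by
  have hν1 : 0 < 1 + ν := by linarith
  have hppos : ∀ᶠ u in nhds (0 : ℝ), 0 < p u :=
    hp.continuousAt.eventually (lt_mem_nhds (by rw [hp0]; norm_num))
  have hsum := hasFPowerSeriesAt_iff.1 (hasFPowerSeriesAt_taylorSeriesZero ga)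
  have hev := h.and (hppos.and (hp.eventually_analyticAt.and hsum))
  obtain ⟨T, hT, hball⟩ := Metric.eventually_nhds_iff.1
    (((continuous_pow 2).tendsto' (0 : ℝ) 0 (by norm_num)).eventually hev)
  set S : ℝ := 2 * Real.sqrt (1 + ν) with hS
  have hSpos : 0 < S := by positivity
  have hS2 : S ^ 2 = 4 * (1 + ν) := by rw [hS, mul_pow, Real.sq_sqrt hν1.le]; norm_num
  refine ⟨T, hT, fun t => S * (t * p (t ^ 2)), fun t ht => ?_⟩
  obtain ⟨e1, e2, e3, e4⟩ := hball (y := t) (by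
    rw [Real.dist_eq, sub_zero, abs_of_pos ht.1]; exact ht.2)
  have hXpos : 0 < S * (t * p (t ^ 2)) := mul_pos hSpos (mul_pos ht.1 e2)
  have hd := hasDerivAt_inversion_map S e3.differentiableAt
  refine ⟨hXpos, ?_, hd.differentiableAt, ?_⟩
  · have h2 : (S * (t * p (t ^ 2))) ^ 2 / (4 * (1 + ν)) = t ^ 2 * p (t ^ 2) ^ 2 := by
      rw [← hS2]; field_simp
    rw [besselPhase, besselINorm_eq hν hXpos, h2, e1, Real.log_exp]
  · have h3 : 1 / S * (S * (p (t ^ 2) + 2 * t ^ 2 * deriv p (t ^ 2))) = g (t ^ 2) := by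
      rw [hg]; field_simp
    rw [hd.deriv, h3]
    simpa [FormalMultilinearSeries.coeff_ofScalars, mul_comm, ← pow_mul] using e4

theorem mainTheorem3 (ν : ℝ) (hν : 0 ≤ ν) :
    (∀ n : ℝ, 0 < n → IntegrableOn (besselIntegrand ν n) (Ioi 0) volume) ∧
    ∃ A : ℕ → ℝ, IsInversionCoeff ν A ∧
      A 0 = 1 ∧
      A 1 = 3 / (4 * (2 + ν)) ∧
      A 2 = -(5 * (1 + 11 * ν)) / (96 * (2 + ν) ^ 2 * (3 + ν)) ∧
      A 3 = -(7 * (20 + 9 * ν - 17 * ν ^ 2)) / (128 * (2 + ν) ^ 3 * (3 + ν) * (4 + ν)) ∧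
      A 4 = (75404 + 262439 * ν + 182205 * ν ^ 2 - 28031 * ν ^ 3 - 19409 * ν ^ 4) /
        (10240 * (2 + ν) ^ 4 * (3 + ν) ^ 2 * (4 + ν) * (5 + ν)) ∧
      A 5 = 11 * (127864 - 364742 * ν - 1417421 * ν ^ 2 - 966731 * ν ^ 3 + 8605 * ν ^ 4
          + 48361 * ν ^ 5) /
        (122880 * (2 + ν) ^ 5 * (3 + ν) ^ 2 * (4 + ν) * (5 + ν) * (6 + ν)) ∧
      ∀ N : ℕ,
        (fun n : ℝ => besselIntegral ν n -
          (1 + ν) ^ (1 / 2 : ℝ) *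
            ∑ k ∈ Finset.range N, A k * Real.Gamma (k + 1 / 2) / n ^ ((k : ℝ) + 1 / 2))
        =O[atTop] (fun n : ℝ => 1 / n ^ ((N : ℝ) + 1 / 2)) := by
  refine ⟨fun n hn => integrableOn_besselIntegrand hν hn, ?_⟩
  obtain ⟨p, hp, hp0, h⟩ := exists_inversion_profile hν
  obtain ⟨g, hg⟩ : ∃ g : ℝ → ℝ, g = fun u => p u + 2 * u * deriv p u := ⟨_, rfl⟩
  have ga : AnalyticAt ℝ g 0 := by
    rw [hg]
    exact hp.fun_add ((analyticAt_const.fun_mul analyticAt_id).fun_mul hp.deriv)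
  have hPG := inversion_profile_taylorSeriesZero hp hg
  have h0 : PowerSeries.coeff 0 (taylorSeriesZero g) = 1 := by
    rw [taylorSeriesZero, PowerSeries.coeff_mk]
    simp [hg, hp0]
  have hode := taylorSeriesZero_inversion_profile_ode hp ga (ν := ν) (by
    filter_upwards [inversion_profile_ode hν hp hp0 h hg] with u hu
    linear_combination hu)
  obtain ⟨h1, h2, h3, h4, h5⟩ := inversion_coeff_values hν
    (A := fun k => PowerSeries.coeff k (taylorSeriesZero g)) (fun _ => rfl)
    (fun n => by
      have : (2 * (n : ℝ) + 1) ≠ 0 := by positivity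
      rw [hPG n, mul_div_cancel_left₀ _ this])
    (fun n => coeff_taylorSeriesZero_deriv n) h0 hode
  exact ⟨_, isInversionCoeff_taylorSeriesZero hν hp hp0 h hg ga, h0, h1, h2, h3, h4, h5,
    besselIntegral_isBigO hν hp hp0 h hg ga⟩
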